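/- **Theorem 3.14.** For sets $X,Y$ and partial functions $f,g\colon X\rightharpoonup Y$ (viewed as subsets of $X\times Y$), let $f-g$ be the set-theoretic difference and let $f\vartriangleright g=\{(x,y)\in g \mid x\in\operatorname{dom} f\}$. A *difference–restriction algebra* is a nonempty algebra $(A,-,\vartriangleright)$ isomorphic to an algebra of partial functions (from some set to some set) closed under these two operations. Let $\mathsf{DRA}$ be the category of difference–restriction algebras and $\{-,\vartriangleright\}$-homomorphisms. On such an algebra put $a\cdot b=a-(a-b)$ and $a\le b\iff a\cdot b=a$. A *Hausdorff étale space* is a surjective local homeomorphism $\pi\colon X\twoheadrightarrow X_0$ between Hausdorff spaces. Let $\mathsf{HausEt}$ be the category whose objects are the Hausdorff étale spaces and whose morphisms from $\pi\colon X\twoheadrightarrow X_0$ to $\rho\colon Y\twoheadrightarrow Y_0$ are the partial functions $\varphi\colon X\rightharpoonup Y$ such that - $\varphi$ is continuous ($\varphi^{-1}(V)$ is open for every open $V\subseteq Y$) and proper ($\varphi^{-1}(V)$ is compact for every compact $V\subseteq Y$); - $\varphi$ preserves equivalence: if $\varphi(x),\varphi(x')$ are defined and $\pi(x)=\pi(x')$,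 then $\rho(\varphi(x))=\rho(\varphi(x'))$; - $\varphi$ is fibrewise injective: if $\pi(x)=\pi(x')$ and $\varphi(x)=\varphi(x')$ (both defined), then $x=x'$; - $\varphi$ is fibrewise surjective: if $\varphi(x)$ is defined and $\rho(y')=\rho(\varphi(x))$, then $y'=\varphi(x')$ for some $x'\in\operatorname{dom}\varphi$ with $\pi(x')=\pi(x)$; composition being composition of partial functions. *The functor $F\colon\mathsf{DRA}\to\mathsf{HausEt}^{\mathrm{op}}$.* For a difference–restriction algebra $A$, let $\operatorname{Pf}(A)$ be the set of maximal (nonempty) proper filters of $(A,\le)$, with the topology generated by the sets $\widehat a=\{\mu \mid a\in\mu\}$, $a\in A$. Let $\mu\approx_A\nu$ mean that $a\vartriangleright b\in\nu$ and $b\vartriangleright a\in\mu$ for all $a\in\mu$, $b\in\nu$. This is an equivalence relation; give $\operatorname{Pf}(A)/{\approx_A}$ the quotient topology. Then $F(A)$ is the quotient map $\pi_A\colon\operatorname{Pf}(A)\twoheadrightarrow\operatorname{Pf}(A)/{\approx_A}$, and for a homomorphism $h\colon A\to B$ the partial function $Fh\colon\operatorname{Pf}(B)\rightharpoonup\operatorname{Pf}(A)$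 has domain $\bigcup_{a\in A}\widehat{h(a)}$ and is given there by $Fh(\xi)=h^{-1}(\xi)$. *The functor $G\colon\mathsf{HausEt}^{\mathrm{op}}\to\mathsf{DRA}$.* For a Hausdorff étale space $\pi\colon X\twoheadrightarrow X_0$, $G(\pi)=\mathrm{KO}(\pi)$ is the set of compact open $U\subseteq X$ on which $\pi$ is injective, with $U-V$ the set difference and $U\vartriangleright V=\pi^{-1}(\pi(U))\cap V$. For a morphism $\varphi$ from $\pi$ to $\rho$, $G\varphi\colon\mathrm{KO}(\rho)\to\mathrm{KO}(\pi)$ is $U\mapsto\varphi^{-1}(U)$. Then $F$ and $G$ are well-defined functors and form an adjunction $F\dashv G$ between $\mathsf{DRA}$ and $\mathsf{HausEt}^{\mathrm{op}}$ (that is, a contravariant adjunction between $\mathsf{DRA}$ and $\mathsf{HausEt}$). -/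

import Mathlib

open CategoryTheory Opposite

universe u

namespace DiffRestr

/-! ### Difference–restriction algebras -/

/-- Relative complement of partial functions: the graph of `f` minus the graph of `g`. -/
def pfunDiff {X Y : Type*} (f g : X →. Y) : X →. Y :=
  f.restrict (p := {x | ∃ y ∈ f x, y ∉ g x})
    (fun x hx => (PFun.mem_dom f x).2 ⟨hx.choose, hx.choose_spec.1⟩)

/-- Domain restriction of partial functions: `g` restricted to the domain of `f`. -/
def pfunRestr {X Y : Type*} (f g : X →. Y) : X →. Y :=
  g.restrict (p := f.Dom ∩ g.Dom) Set.inter_subset_right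

theorem mem_pfunDiff {X Y : Type*} (f g : X →. Y) (x : X) (y : Y) :
    y ∈ pfunDiff f g x ↔ y ∈ f x ∧ y ∉ g x := by
  refine (PFun.mem_restrict _ x y).trans ?_
  constructor
  · rintro ⟨⟨z, hz, hzg⟩, hy⟩
    obtain rfl := Part.mem_unique hz hy
    exact ⟨hz, hzg⟩
  · rintro ⟨h1, h2⟩
    exact ⟨⟨y, h1, h2⟩, h1⟩

theorem mem_pfunRestr {X Y : Type*} (f g : X →. Y) (x : X) (y : Y) :
    y ∈ pfunRestr f g x ↔ x ∈ f.Dom ∧ y ∈ g x := by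
  refine (PFun.mem_restrict _ x y).trans ?_
  constructor
  · rintro ⟨⟨h1, -⟩, h2⟩
    exact ⟨h1, h2⟩
  · rintro ⟨h1, h2⟩
    exact ⟨⟨h1, (PFun.mem_dom g x).2 ⟨y, h2⟩⟩, h2⟩

/-- A difference–restriction algebra: a nonempty algebra with two binary operations that is
isomorphic to an algebra of partial functions with relative complement and domain restriction
(that is, it embeds into the algebra of all partial functions between two sets). Taking the two
sets in the universe of the carrier is no restriction: a representable algebra embeds into the
partial functions from a quotient of its set of maximal filters to that set. -/
structure DRA : Type (u + 1) where
  carrier : Type u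
  nonempty : Nonempty carrier
  /-- the operation `a - b` -/
  diff : carrier → carrier → carrier
  /-- the domain restriction operation, `b` restricted to the domain of `a` -/
  restr : carrier → carrier → carrier
  representable : ∃ (X Y : Type u) (ρ : carrier → (X →. Y)),
    Function.Injective ρ ∧
    (∀ a b, ρ (diff a b) = pfunDiff (ρ a) (ρ b)) ∧
    (∀ a b, ρ (restr a b) = pfunRestr (ρ a) (ρ b))

namespace DRA

instance : CoeSort DRA.{u} (Type u) := ⟨DRA.carrier⟩

/-- Homomorphisms of algebras of the signature (difference, restriction). -/
@[ext]
structure Hom (A B : DRA.{u}) : Type u where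
  toFun : A → B
  map_diff : ∀ a b, toFun (A.diff a b) = B.diff (toFun a) (toFun b)
  map_restr : ∀ a b, toFun (A.restr a b) = B.restr (toFun a) (toFun b)

instance : Category DRA.{u} where
  Hom A B := Hom A B
  id A := ⟨fun a => a, fun _ _ => rfl, fun _ _ => rfl⟩
  comp f g := ⟨fun a => g.toFun (f.toFun a),
    fun a b => by rw [f.map_diff, g.map_diff], fun a b => by rw [f.map_restr, g.map_restr]⟩

variable (A : DRA.{u})

/-- The derived meet `a · b = a - (a - b)`. -/
def meet (a b : A) : A := A.diff a (A.diff a b)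

/-- A representation by partial functions, written with relations. -/
theorem rep : ∃ (X Y : Type u) (R : A → X → Y → Prop),
    (∀ a x y z, R a x y → R a x z → y = z) ∧
    (∀ a b, (∀ x y, R a x y ↔ R b x y) → a = b) ∧
    (∀ a b x y, R (A.diff a b) x y ↔ R a x y ∧ ¬ R b x y) ∧
    (∀ a b x y, R (A.restr a b) x y ↔ (∃ z, R a x z) ∧ R b x y) ∧
    (∀ a b, A.meet a b = a ↔ ∀ x y, R a x y → R b x y) ∧
    (∀ a b x y, R (A.meet a b) x y ↔ R a x y ∧ R b x y) := by
  obtain ⟨X, Y, ρ, hinj, hd, hr⟩ := A.representable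
  have h2 : ∀ a b : A, (∀ x y, y ∈ ρ a x ↔ y ∈ ρ b x) → a = b :=
    fun a b h => hinj (PFun.ext h)
  have h3 : ∀ a b x y, y ∈ ρ (A.diff a b) x ↔ y ∈ ρ a x ∧ ¬ y ∈ ρ b x := by
    intro a b x y; rw [hd, mem_pfunDiff]
  have h6 : ∀ a b x y, y ∈ ρ (A.meet a b) x ↔ y ∈ ρ a x ∧ y ∈ ρ b x := by
    intro a b x y; unfold meet; rw [h3, h3]; tauto
  refine ⟨X, Y, fun a x y => y ∈ ρ a x, fun a x y z => Part.mem_unique, h2, h3, ?_, ?_, h6⟩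
  · intro a b x y
    show y ∈ ρ (A.restr a b) x ↔ _
    rw [hr]
    exact (mem_pfunRestr _ _ x y).trans (and_congr_left' (PFun.mem_dom _ _))
  · intro a b
    constructor
    · intro h x y hy
      rw [← h, h6] at hy
      exact hy.2
    · intro h
      refine h2 _ _ fun x y => ?_
      rw [h6]
      exact ⟨fun t => t.1, fun t => ⟨t, h x y t⟩⟩

/-- The order of the meet-semilattice: `a ≤ b` iff `a · b = a`. -/
instance : PartialOrder A.carrier where
  le a b := A.meet a b = a
  le_refl a := by
    obtain ⟨X, Y, R, -, -, -, -, hle, -⟩ := A.rep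
    exact (hle a a).2 fun _ _ h => h
  le_trans a b c hab hbc := by
    obtain ⟨X, Y, R, -, -, -, -, hle, -⟩ := A.rep
    exact (hle a c).2 fun x y h => (hle b c).1 hbc x y ((hle a b).1 hab x y h)
  le_antisymm a b hab hba := by
    obtain ⟨X, Y, R, -, hext, -, -, hle, -⟩ := A.rep
    exact hext a b fun x y => ⟨(hle a b).1 hab x y, (hle b a).1 hba x y⟩

variable {A}

theorem le_iff {a b : A} : a ≤ b ↔ A.meet a b = a := Iff.rfl

theorem meet_le_left (a b : A) : A.meet a b ≤ a := by
  obtain ⟨X, Y, R, -, -, -, -, hle, hm⟩ := A.rep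
  exact (hle _ _).2 fun x y h => ((hm _ _ _ _).1 h).1

theorem meet_le_right (a b : A) : A.meet a b ≤ b := by
  obtain ⟨X, Y, R, -, -, -, -, hle, hm⟩ := A.rep
  exact (hle _ _).2 fun x y h => ((hm _ _ _ _).1 h).2

theorem le_meet {a b c : A} (h1 : c ≤ a) (h2 : c ≤ b) : c ≤ A.meet a b := by
  obtain ⟨X, Y, R, -, -, -, -, hle, hm⟩ := A.rep
  exact (hle _ _).2 fun x y h => (hm _ _ _ _).2 ⟨(hle _ _).1 h1 x y h, (hle _ _).1 h2 x y h⟩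

theorem diff_le (a b : A) : A.diff a b ≤ a := by
  obtain ⟨X, Y, R, -, -, hd, -, hle, hm⟩ := A.rep
  exact (hle _ _).2 fun x y h => ((hd _ _ _ _).1 h).1

theorem diff_self_le (a b : A) : A.diff a a ≤ b := by
  obtain ⟨X, Y, R, -, -, hd, -, hle, hm⟩ := A.rep
  exact (hle _ _).2 fun x y h => absurd ((hd _ _ _ _).1 h).1 ((hd _ _ _ _).1 h).2

theorem restr_le (a b : A) : A.restr a b ≤ b := by
  obtain ⟨X, Y, R, -, -, -, hr, hle, hm⟩ := A.rep
  exact (hle _ _).2 fun x y h => ((hr _ _ _ _).1 h).2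

theorem restr_mono {a b c d : A} (h1 : a ≤ c) (h2 : b ≤ d) : A.restr a b ≤ A.restr c d := by
  obtain ⟨X, Y, R, -, -, -, hr, hle, hm⟩ := A.rep
  refine (hle _ _).2 fun x y h => ?_
  obtain ⟨⟨z, hz⟩, hy⟩ := (hr _ _ _ _).1 h
  exact (hr _ _ _ _).2 ⟨⟨z, (hle _ _).1 h1 x z hz⟩, (hle _ _).1 h2 x y hy⟩

theorem meet_le_restr (a b : A) : A.meet a b ≤ A.restr a b := by
  obtain ⟨X, Y, R, -, -, -, hr, hle, hm⟩ := A.rep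
  refine (hle _ _).2 fun x y h => ?_
  obtain ⟨h1, h2⟩ := (hm _ _ _ _).1 h
  exact (hr _ _ _ _).2 ⟨⟨y, h1⟩, h2⟩

theorem restr_restr_le (a b c : A) : A.restr (A.restr a b) c ≤ A.restr a c := by
  obtain ⟨X, Y, R, -, -, -, hr, hle, hm⟩ := A.rep
  refine (hle _ _).2 fun x y h => ?_
  obtain ⟨⟨z, hz⟩, hy⟩ := (hr _ _ _ _).1 h
  exact (hr _ _ _ _).2 ⟨((hr _ _ _ _).1 hz).1, hy⟩

/-- An element below `c` whose domain lies in that of `a ≤ c` is below `a`. -/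
theorem restr_le_of_le {a b c : A} (ha : a ≤ c) (hb : b ≤ c) : A.restr a b ≤ a := by
  obtain ⟨X, Y, R, hf, -, -, hr, hle, hm⟩ := A.rep
  refine (hle _ _).2 fun x y h => ?_
  obtain ⟨⟨z, hz⟩, hy⟩ := (hr _ _ _ _).1 h
  have := hf c x z y ((hle _ _).1 ha x z hz) ((hle _ _).1 hb x y hy)
  exact this ▸ hz

theorem restr_diff_restr_le (a b c : A) :
    A.restr a (A.diff b (A.restr a b)) ≤ c := by
  obtain ⟨X, Y, R, hf, -, hd, hr, hle, hm⟩ := A.rep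
  refine (hle _ _).2 fun x y h => ?_
  obtain ⟨hz, hy⟩ := (hr _ _ _ _).1 h
  obtain ⟨h1, h2⟩ := (hd _ _ _ _).1 hy
  exact absurd ((hr _ _ _ _).2 ⟨hz, h1⟩) h2

theorem diff_meet_diff_le (a b c : A) : A.diff (A.meet a b) c ≤ A.meet (A.diff a c) (A.diff b c) := by
  obtain ⟨X, Y, R, hf, -, hd, hr, hle, hm⟩ := A.rep
  refine (hle _ _).2 fun x y h => ?_
  obtain ⟨h1, h2⟩ := (hd _ _ _ _).1 h
  obtain ⟨h3, h4⟩ := (hm _ _ _ _).1 h1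
  exact (hm _ _ _ _).2 ⟨(hd _ _ _ _).2 ⟨h3, h2⟩, (hd _ _ _ _).2 ⟨h4, h2⟩⟩

theorem le_of_diff_le {a b : A} (h : A.diff a b ≤ A.diff b b) : a ≤ b := by
  obtain ⟨X, Y, R, hf, -, hd, hr, hle, hm⟩ := A.rep
  refine (hle _ _).2 fun x y h1 => ?_
  by_contra h2
  have := (hd _ _ _ _).1 ((hle _ _).1 h x y ((hd _ _ _ _).2 ⟨h1, h2⟩))
  exact this.2 this.1

theorem meet_diff_le (a b c : A) : A.meet (A.diff a b) b ≤ c := by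
  obtain ⟨X, Y, R, hf, -, hd, hr, hle, hm⟩ := A.rep
  refine (hle _ _).2 fun x y h => ?_
  obtain ⟨h1, h2⟩ := (hm _ _ _ _).1 h
  exact absurd h2 ((hd _ _ _ _).1 h1).2

theorem Hom.map_meet {A B : DRA.{u}} (h : Hom A B) (a b : A) :
    h.toFun (A.meet a b) = B.meet (h.toFun a) (h.toFun b) := by
  unfold meet; rw [h.map_diff, h.map_diff]

theorem Hom.mono {A B : DRA.{u}} (h : Hom A B) {a b : A} (hab : a ≤ b) :
    h.toFun a ≤ h.toFun b := by
  rw [le_iff] at hab ⊢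
  rw [← h.map_meet, hab]

theorem meet_mem {F : Order.PFilter A} {a b : A} (ha : a ∈ F) (hb : b ∈ F) : A.meet a b ∈ F := by
  obtain ⟨c, hc, hca, hcb⟩ := F.directed a ha b hb
  exact Order.PFilter.mem_of_le (le_meet hca hcb) hc

/-- A nonempty up-set closed under binary meets is a filter. -/
def mkFilter (S : Set A) (hne : S.Nonempty) (hup : ∀ {a b : A}, a ≤ b → a ∈ S → b ∈ S)
    (hm : ∀ {a b : A}, a ∈ S → b ∈ S → A.meet a b ∈ S) : Order.PFilter A :=
  (Order.IsPFilter.of_def hne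
    (fun a ha b hb => ⟨A.meet a b, hm ha hb, meet_le_left a b, meet_le_right a b⟩)
    hup).toPFilter

theorem mem_mkFilter {S : Set A} {hne : S.Nonempty} {hup : ∀ {a b : A}, a ≤ b → a ∈ S → b ∈ S}
    {hm : ∀ {a b : A}, a ∈ S → b ∈ S → A.meet a b ∈ S} {a : A} :
    a ∈ mkFilter S hne hup hm ↔ a ∈ S := Iff.rfl

variable (A)

/-- The set `Pf(A)` of maximal filters: filters that are maximal with respect to inclusion among
the proper filters of the poset `A`. -/
def Pf : Type u :=
  {μ : Order.PFilter A.carrier // Maximal (fun F : Order.PFilter A.carrier => (F : Set A) ≠ Set.univ) μ}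

variable {A}

instance : Membership A.carrier A.Pf := ⟨fun μ a => a ∈ μ.1⟩

namespace Pf

theorem ext {μ ν : A.Pf} (h : ∀ a : A, a ∈ μ ↔ a ∈ ν) : μ = ν :=
  Subtype.ext (SetLike.ext h)

theorem nonempty (μ : A.Pf) : ∃ a : A, a ∈ μ := μ.1.nonempty

theorem up {μ : A.Pf} {a b : A} (h : a ≤ b) (ha : a ∈ μ) : b ∈ μ :=
  Order.PFilter.mem_of_le h ha

theorem meet_mem {μ : A.Pf} {a b : A} (ha : a ∈ μ) (hb : b ∈ μ) : A.meet a b ∈ μ :=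
  DRA.meet_mem ha hb

theorem not_bot_mem {μ : A.Pf} {z : A} (hz : ∀ c : A, z ≤ c) : z ∉ μ := fun h =>
  μ.2.1 (Set.eq_univ_of_forall fun c => Order.PFilter.mem_of_le (hz c) h)

/-- If `a` belongs to a maximal filter and `b` does not, then `a - b` does. -/
theorem diff_mem {μ : A.Pf} {a b : A} (ha : a ∈ μ) (hb : b ∉ μ) : A.diff a b ∈ μ := by
  let F : Order.PFilter A.carrier := mkFilter {x | ∃ m : A, m ∈ μ ∧ A.diff m b ≤ x}
    ⟨_, a, ha, le_refl _⟩ (fun h ⟨m, hm, hmx⟩ => ⟨m, hm, hmx.trans h⟩)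
    (fun {x y} ⟨m, hm, hmx⟩ ⟨n, hn, hny⟩ => ⟨A.meet m n, meet_mem hm hn,
      (diff_meet_diff_le m n b).trans
        (le_meet ((meet_le_left _ _).trans hmx) ((meet_le_right _ _).trans hny))⟩)
  have hF : (F : Set A) ≠ Set.univ := by
    intro h
    have hz : A.diff b b ∈ (F : Set A) := h ▸ Set.mem_univ _
    obtain ⟨m, hm, hmz⟩ := hz
    exact hb (up (le_of_diff_le hmz) hm)
  have hle : μ.1 ≤ F := fun x hx => ⟨x, hx, diff_le _ _⟩
  exact μ.2.2 hF hle ⟨a, ha, le_refl _⟩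

theorem maximal_of {F : Order.PFilter A.carrier} (h0 : ∀ a : A, A.diff a a ∉ F)
    (h : ∀ a b : A, a ∈ F → b ∉ F → A.diff a b ∈ F) :
    Maximal (fun F : Order.PFilter A.carrier => (F : Set A) ≠ Set.univ) F := by
  obtain ⟨a, ha⟩ := F.nonempty
  refine ⟨fun hu => h0 a (hu ▸ Set.mem_univ _ : A.diff a a ∈ (F : Set A)), fun G hG hFG b hb => ?_⟩
  by_contra hbF
  refine hG (Set.eq_univ_of_forall fun c => ?_)
  exact Order.PFilter.mem_of_le (meet_diff_le a b c) (DRA.meet_mem (hFG (h a b ha hbF)) hb)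

theorem ext_of_le {μ ν : A.Pf} (h : ∀ a : A, a ∈ μ → a ∈ ν) : μ = ν :=
  Subtype.ext (le_antisymm h (μ.2.2 ν.2.1 h))

/-- The sets `â = {μ | a ∈ μ}`. -/
def hat (a : A) : Set A.Pf := {μ | a ∈ μ}

/-- The topology on `Pf(A)` generated by the sets `â`. -/
instance : TopologicalSpace A.Pf :=
  TopologicalSpace.generateFrom (Set.range (hat (A := A)))

theorem isOpen_hat (a : A) : IsOpen (hat a) :=
  TopologicalSpace.isOpen_generateFrom_of_mem ⟨a, rfl⟩

theorem isTopologicalBasis : TopologicalSpace.IsTopologicalBasis (Set.range (hat (A := A))) where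
  exists_subset_inter := by
    rintro _ ⟨a, rfl⟩ _ ⟨b, rfl⟩ μ ⟨ha, hb⟩
    exact ⟨_, ⟨A.meet a b, rfl⟩, meet_mem ha hb,
      fun ν hν => ⟨up (meet_le_left a b) hν, up (meet_le_right a b) hν⟩⟩
  sUnion_eq := Set.eq_univ_of_forall fun μ =>
    let ⟨a, ha⟩ := μ.nonempty; ⟨_, ⟨a, rfl⟩, ha⟩
  eq_generateFrom := rfl

instance : T2Space A.Pf := ⟨by
  intro μ ν hne
  have : ∃ a : A, a ∈ μ ∧ a ∉ ν := by
    by_contra! h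
    exact hne (ext_of_le h)
  obtain ⟨a, ha, haν⟩ := this
  obtain ⟨b, hb⟩ := ν.nonempty
  refine ⟨hat a, hat (A.diff b a), isOpen_hat _, isOpen_hat _, ha, diff_mem hb haν, ?_⟩
  rw [Set.disjoint_left]
  intro ξ h1 h2
  exact not_bot_mem (meet_diff_le b a) (meet_mem h2 h1)⟩

theorem isCompact_hat (a : A) : IsCompact (hat a) := by
  rw [isCompact_iff_ultrafilter_le_nhds]
  intro U hU
  have haU : hat a ∈ U := Filter.le_principal_iff.1 hU
  let F : Order.PFilter A.carrier := mkFilter {x | hat x ∈ U} ⟨a, haU⟩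
    (fun h hx => Filter.mem_of_superset hx fun _ => up h)
    (fun {x y} hx hy => Filter.mem_of_superset (Filter.inter_mem hx hy) fun _ h => meet_mem h.1 h.2)
  have hF : Maximal (fun F : Order.PFilter A.carrier => (F : Set A) ≠ Set.univ) F := by
    refine maximal_of (fun c hc => ?_) fun x y hx hy => ?_
    · have hc' : hat (A.diff c c) ∈ U := hc
      obtain ⟨ξ, hξ⟩ := U.nonempty_of_mem hc'
      exact not_bot_mem (diff_self_le c) hξ
    · have hx' : hat x ∈ U := hx
      have hy' : (hat y)ᶜ ∈ U := Ultrafilter.compl_mem_iff_notMem.2 hy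
      exact Filter.mem_of_superset (Filter.inter_mem hx' hy') fun ξ h => diff_mem h.1 h.2
  let μ : A.Pf := ⟨F, hF⟩
  refine ⟨μ, haU, (?_ : (U : Filter A.Pf) ≤ nhds μ)⟩
  rw [TopologicalSpace.nhds_generateFrom]
  refine le_iInf₂ fun s hs => ?_
  obtain ⟨hμ, b, rfl⟩ := hs
  exact Filter.le_principal_iff.2 hμ

/-- A compact set of maximal filters is covered by finitely many sets `â`. -/
theorem exists_cover {K : Set A.Pf} (hK : IsCompact K) :
    ∃ t : Finset A.carrier, K ⊆ ⋃ a ∈ t, hat a :=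
  hK.elim_finite_subcover (fun a : A.carrier => hat a) isOpen_hat fun μ _ =>
    Set.mem_iUnion.2 μ.nonempty

end Pf

/-- The domain inclusion preorder on filters: `F` is below `G` iff `g ▷ f ∈ F` for all `g ∈ G`,
`f ∈ F`. -/
def FilterDomLE (F G : Order.PFilter A.carrier) : Prop :=
  ∀ g ∈ G, ∀ f ∈ F, A.restr g f ∈ F

theorem FilterDomLE.refl (F : Order.PFilter A.carrier) : FilterDomLE F F :=
  fun g hg f hf => Order.PFilter.mem_of_le (meet_le_restr g f) (DRA.meet_mem hg hf)

theorem FilterDomLE.trans {F G H : Order.PFilter A.carrier} (h1 : FilterDomLE F G)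
    (h2 : FilterDomLE G H) : FilterDomLE F H := by
  intro h hh f hf
  obtain ⟨g, hg⟩ := G.nonempty
  exact Order.PFilter.mem_of_le (restr_restr_le h g f) (h1 _ (h2 h hh g hg) f hf)

variable (A) in
/-- The equivalence relation `≈` on maximal filters induced by the domain inclusion preorder. -/
instance pfSetoid : Setoid A.Pf where
  r μ ν := FilterDomLE μ.1 ν.1 ∧ FilterDomLE ν.1 μ.1
  iseqv := ⟨fun _ => ⟨.refl _, .refl _⟩, fun h => ⟨h.2, h.1⟩,
    fun h1 h2 => ⟨h1.1.trans h2.1, h2.2.trans h1.2⟩⟩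

namespace Pf

theorem equiv_def {μ ν : A.Pf} : μ ≈ ν ↔ FilterDomLE μ.1 ν.1 ∧ FilterDomLE ν.1 μ.1 := Iff.rfl

theorem restr_mem {μ ν : A.Pf} (h : μ ≈ ν) {a b : A} (ha : a ∈ μ) (hb : b ∈ ν) :
    A.restr a b ∈ ν := h.2 a ha b hb

/-- On maximal filters, domain inclusion in one direction suffices. -/
theorem equiv_iff {μ ν : A.Pf} : μ ≈ ν ↔ ∀ a ∈ μ, ∀ b ∈ ν, A.restr a b ∈ ν := by
  refine ⟨fun h => h.2, fun h => ⟨fun b hb a ha => ?_, h⟩⟩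
  by_contra hba
  have h1 : A.diff a (A.restr b a) ∈ μ := diff_mem ha hba
  have h2 := h _ h1 _ (h _ h1 b hb)
  refine not_bot_mem (fun c => ?_) h2
  obtain ⟨X, Y, R, hf, -, hd, hr, hle, hm⟩ := A.rep
  refine (hle _ _).2 fun x y hxy => ?_
  obtain ⟨⟨z, hz⟩, hy⟩ := (hr _ _ _ _).1 hxy
  obtain ⟨-, hy⟩ := (hr _ _ _ _).1 hy
  obtain ⟨hz1, hz2⟩ := (hd _ _ _ _).1 hz
  exact absurd ((hr _ _ _ _).2 ⟨⟨y, hy⟩, hz1⟩) hz2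

theorem eq_of_equiv {μ ν : A.Pf} (h : μ ≈ ν) {c : A} (hμ : c ∈ μ) (hν : c ∈ ν) : μ = ν := by
  refine ext_of_le fun a ha => ?_
  have h1 : A.meet a c ∈ μ := meet_mem ha hμ
  exact up ((restr_le_of_le (meet_le_right a c) le_rfl).trans (meet_le_left a c))
    (restr_mem h h1 hν)

/-- The canonical quotient map. -/
def proj (μ : A.Pf) : Quotient (pfSetoid A) := Quotient.mk _ μ

theorem proj_eq {μ ν : A.Pf} : proj μ = proj ν ↔ μ ≈ ν := Quotient.eq

theorem continuous_proj : Continuous (proj (A := A)) := continuous_quotient_mk'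

/-- If `a ▷ b` belongs to a maximal filter, then `a` belongs to some equivalent maximal filter. -/
theorem exists_equiv_mem {ξ : A.Pf} {a b : A} (hξ' : A.restr a b ∈ ξ) :
    ∃ ζ : A.Pf, a ∈ ζ ∧ ζ ≈ ξ := by
  -- the filter generated by the elements `x ▷ a` with `x ∈ ξ` is a maximal filter over `ξ`
  let F : Order.PFilter A.carrier := mkFilter {y | ∃ x : A, x ∈ ξ ∧ A.restr x a ≤ y}
    ⟨_, _, hξ', le_rfl⟩ (fun h ⟨x, hx, hxy⟩ => ⟨x, hx, hxy.trans h⟩)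
    (fun {y z} ⟨x, hx, hxy⟩ ⟨x', hx', hxz⟩ => ⟨A.meet x x', meet_mem hx hx',
      le_meet ((restr_mono (meet_le_left _ _) le_rfl).trans hxy)
        ((restr_mono (meet_le_right _ _) le_rfl).trans hxz)⟩)
  have hFmem : ∀ {y : A}, y ∈ F ↔ ∃ x : A, x ∈ ξ ∧ A.restr x a ≤ y := Iff.rfl
  have hF : Maximal (fun F : Order.PFilter A.carrier => (F : Set A) ≠ Set.univ) F := by
    refine maximal_of (fun c hc => ?_) fun y z hy hz => ?_
    · obtain ⟨x, hx, hxc⟩ := hFmem.1 hc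
      refine not_bot_mem (fun d => ?_) (meet_mem hx hξ')
      obtain ⟨X, Y, R, hf, -, hd, hr, hle, hm⟩ := A.rep
      refine (hle _ _).2 fun p q hpq => ?_
      obtain ⟨h1, h2⟩ := (hm _ _ _ _).1 hpq
      obtain ⟨⟨r, h3⟩, h4⟩ := (hr _ _ _ _).1 h2
      have := (hd _ _ _ _).1 ((hle _ _).1 hxc p r ((hr _ _ _ _).2 ⟨⟨q, h1⟩, h3⟩))
      exact absurd this.1 this.2
    · obtain ⟨x, hx, hxy⟩ := hFmem.1 hy
      -- the part of `b` on the domain where `a` and `z` agree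
      have hn : A.restr (A.meet a z) b ∉ ξ := fun hn => hz (hFmem.2 ⟨_, hn, by
        obtain ⟨X, Y, R, hf, -, hd, hr, hle, hm⟩ := A.rep
        refine (hle _ _).2 fun p q hpq => ?_
        obtain ⟨⟨r, h1⟩, h2⟩ := (hr _ _ _ _).1 hpq
        obtain ⟨⟨s, h3⟩, h4⟩ := (hr _ _ _ _).1 h1
        obtain ⟨h5, h6⟩ := (hm _ _ _ _).1 h3
        exact hf _ _ _ _ h5 h2 ▸ h6⟩)
      refine hFmem.2 ⟨_, meet_mem hx (diff_mem hξ' hn), ?_⟩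
      obtain ⟨X, Y, R, hf, -, hd, hr, hle, hm⟩ := A.rep
      refine (hle _ _).2 fun p q hpq => ?_
      obtain ⟨⟨r, h1⟩, h2⟩ := (hr _ _ _ _).1 hpq
      obtain ⟨h3, h4⟩ := (hm _ _ _ _).1 h1
      obtain ⟨h5, h6⟩ := (hd _ _ _ _).1 h4
      refine (hd _ _ _ _).2 ⟨(hle _ _).1 hxy p q ((hr _ _ _ _).2 ⟨⟨r, h3⟩, h2⟩), fun h7 => h6 ?_⟩
      exact (hr _ _ _ _).2 ⟨⟨q, (hm _ _ _ _).2 ⟨h2, h7⟩⟩, ((hr _ _ _ _).1 h5).2⟩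
  refine ⟨⟨F, hF⟩, hFmem.2 ⟨_, hξ', restr_le _ _⟩, Setoid.symm (equiv_iff.2 ?_)⟩
  intro x hx y hy
  obtain ⟨x', hx', hxy⟩ := hFmem.1 hy
  refine hFmem.2 ⟨A.meet x x', meet_mem hx hx', ?_⟩
  obtain ⟨X, Y, R, hf, -, hd, hr, hle, hm⟩ := A.rep
  refine (hle _ _).2 fun p q hpq => ?_
  obtain ⟨⟨r, h1⟩, h2⟩ := (hr _ _ _ _).1 hpq
  obtain ⟨h3, h4⟩ := (hm _ _ _ _).1 h1
  exact (hr _ _ _ _).2 ⟨⟨r, h3⟩, (hle _ _).1 hxy p q ((hr _ _ _ _).2 ⟨⟨r, h4⟩, h2⟩)⟩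

theorem isOpenMap_proj : IsOpenMap (proj (A := A)) := by
  refine isTopologicalBasis.isOpenMap_iff.2 ?_
  rintro _ ⟨a, rfl⟩
  refine isOpen_coinduced.2 (isOpen_iff_forall_mem_open.2 ?_)
  rintro ν ⟨μ, hμ, hμν⟩
  obtain ⟨b, hb⟩ := ν.nonempty
  refine ⟨hat (A.restr a b), fun ξ hξ => ?_, isOpen_hat _, restr_mem (proj_eq.1 hμν) hμ hb⟩
  obtain ⟨ζ, hζ, h⟩ := exists_equiv_mem hξ
  exact ⟨ζ, hζ, proj_eq.2 h⟩

theorem isLocalHomeomorph_proj : IsLocalHomeomorph (proj (A := A)) := by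
  rw [isLocalHomeomorph_iff_isOpenEmbedding_restrict]
  intro μ
  obtain ⟨a, ha⟩ := μ.nonempty
  refine ⟨hat a, (isOpen_hat a).mem_nhds ha, ?_⟩
  refine .of_continuous_injective_isOpenMap (continuous_proj.comp continuous_subtype_val) ?_
    (isOpenMap_proj.domRestrict (isOpen_hat a))
  rintro ⟨ξ, hξ⟩ ⟨ζ, hζ⟩ h
  exact Subtype.ext (eq_of_equiv (proj_eq.1 h) hξ hζ)

instance : T2Space (Quotient (pfSetoid A)) := ⟨by
  intro p q hne
  obtain ⟨μ, rfl⟩ := Quotient.exists_rep p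
  obtain ⟨ν, rfl⟩ := Quotient.exists_rep q
  have : ∃ a ∈ μ, ∃ b ∈ ν, A.restr a b ∉ ν := by
    by_contra! h
    exact hne (proj_eq.2 (equiv_iff.2 h))
  obtain ⟨a, ha, b, hb, hab⟩ := this
  refine ⟨proj '' hat a, proj '' hat (A.diff b (A.restr a b)), isOpenMap_proj _ (isOpen_hat _),
    isOpenMap_proj _ (isOpen_hat _), ⟨μ, ha, rfl⟩, ⟨ν, diff_mem hb hab, rfl⟩, ?_⟩
  rw [Set.disjoint_left]
  rintro _ ⟨ξ, hξ, rfl⟩ ⟨ζ, hζ, h⟩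
  exact not_bot_mem (restr_diff_restr_le a b) (restr_mem (proj_eq.1 h.symm) hξ hζ)⟩

end Pf

end DRA

/-! ### Hausdorff étale spaces -/

/-- A Hausdorff étale space: a surjective local homeomorphism `π : X → X₀` between Hausdorff
spaces. (Hausdorffness of `X₀` does not follow from that of `X`, and without it the compact open
sets on which `π` is injective need not be closed under domain restriction.) -/
structure HausEt : Type (u + 1) where
  X : Type u
  X₀ : Type u
  [topX : TopologicalSpace X]
  [topX₀ : TopologicalSpace X₀]
  [t2X : T2Space X]
  [t2X₀ : T2Space X₀]
  π : X → X₀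
  isLocalHomeomorph : IsLocalHomeomorph π
  surjective : Function.Surjective π

namespace HausEt

attribute [instance] topX topX₀ t2X t2X₀

/-- Morphisms of Hausdorff étale spaces: continuous proper partial functions that preserve
equivalence and are fibrewise injective and fibrewise surjective. Continuity (properness) means
that inverse images of open (compact) sets are open (compact). -/
@[ext]
structure Hom (E E' : HausEt.{u}) : Type u where
  φ : E.X →. E'.X
  continuous : ∀ V : Set E'.X, IsOpen V → IsOpen (φ.preimage V)
  proper : ∀ V : Set E'.X, IsCompact V → IsCompact (φ.preimage V)
  preserves : ∀ x x' : E.X, ∀ y ∈ φ x, ∀ y' ∈ φ x', E.π x = E.π x' → E'.π y = E'.π y'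
  fibre_injective : ∀ x x' : E.X, ∀ y, y ∈ φ x → y ∈ φ x' → E.π x = E.π x' → x = x'
  fibre_surjective : ∀ x : E.X, ∀ y ∈ φ x, ∀ y' : E'.X, E'.π y' = E'.π y →
    ∃ x' : E.X, E.π x' = E.π x ∧ y' ∈ φ x'

theorem mem_comp {X Y Z : Type*} (g : Y →. Z) (f : X →. Y) (x : X) (z : Z) :
    z ∈ g.comp f x ↔ ∃ y ∈ f x, z ∈ g y := by
  exact Part.mem_bind_iff

theorem mem_id {X : Type*} (x y : X) : y ∈ PFun.id X x ↔ y = x := by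
  rw [PFun.id_apply, Part.mem_some_iff]

theorem preimage_id {X : Type*} (V : Set X) : (PFun.id X).preimage V = V := by
  ext x
  simp only [PFun.mem_preimage, mem_id, exists_eq_right]

/-- The identity morphism. -/
def Hom.id (E : HausEt.{u}) : Hom E E where
  φ := PFun.id E.X
  continuous V hV := by rwa [preimage_id]
  proper V hV := by rwa [preimage_id]
  preserves x x' y hy y' hy' h := by
    rw [mem_id] at hy hy'; rw [hy, hy', h]
  fibre_injective x x' y hy hy' _ := by
    rw [mem_id] at hy hy'; rw [← hy, ← hy']
  fibre_surjective x y hy y' h := by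
    rw [mem_id] at hy; subst hy; exact ⟨y', h, (mem_id _ _).2 rfl⟩

/-- Composition of morphisms is composition of partial functions. -/
def Hom.comp {E E' E'' : HausEt.{u}} (f : Hom E E') (g : Hom E' E'') : Hom E E'' where
  φ := g.φ.comp f.φ
  continuous V hV := by
    rw [PFun.preimage_comp]; exact f.continuous _ (g.continuous _ hV)
  proper V hV := by
    rw [PFun.preimage_comp]; exact f.proper _ (g.proper _ hV)
  preserves x x' z hz z' hz' h := by
    obtain ⟨y, hy, hyz⟩ := (mem_comp _ _ _ _).1 hz
    obtain ⟨y', hy', hyz'⟩ := (mem_comp _ _ _ _).1 hz'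
    exact g.preserves y y' z hyz z' hyz' (f.preserves x x' y hy y' hy' h)
  fibre_injective x x' z hz hz' h := by
    obtain ⟨y, hy, hyz⟩ := (mem_comp _ _ _ _).1 hz
    obtain ⟨y', hy', hyz'⟩ := (mem_comp _ _ _ _).1 hz'
    obtain rfl := g.fibre_injective y y' z hyz hyz' (f.preserves x x' y hy y' hy' h)
    exact f.fibre_injective x x' y hy hy' h
  fibre_surjective x z hz z' h := by
    obtain ⟨y, hy, hyz⟩ := (mem_comp _ _ _ _).1 hz
    obtain ⟨y', hy', hyz'⟩ := g.fibre_surjective y z hyz z' h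
    obtain ⟨x', hx', hxy'⟩ := f.fibre_surjective x y hy y' hy'
    exact ⟨x', hx', (mem_comp _ _ _ _).2 ⟨y', hxy', hyz'⟩⟩

instance : Category HausEt.{u} where
  Hom E E' := Hom E E'
  id E := Hom.id E
  comp f g := f.comp g
  id_comp _ := Hom.ext (PFun.comp_id _)
  comp_id _ := Hom.ext (PFun.id_comp _)
  assoc _ _ _ := Hom.ext (PFun.comp_assoc _ _ _).symm

end HausEt

/-! ### The functor `F` -/

namespace DRA

/-- The Hausdorff étale space `π_A : Pf(A) → Pf(A)/≈`. -/
def specObj (A : DRA.{u}) : HausEt.{u} where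
  X := A.Pf
  X₀ := Quotient (pfSetoid A)
  π := Pf.proj
  isLocalHomeomorph := Pf.isLocalHomeomorph_proj
  surjective := Quotient.exists_rep

variable {A B : DRA.{u}}

/-- The inverse image of a maximal filter under a homomorphism, provided it is nonempty. -/
def Hom.comapPf (h : Hom A B) (ξ : B.Pf) (hne : ∃ a : A, h.toFun a ∈ ξ) : A.Pf :=
  ⟨mkFilter {a | h.toFun a ∈ ξ} hne (fun hab ha => Pf.up (h.mono hab) ha)
    (fun {a b} ha hb => by
      show h.toFun (A.meet a b) ∈ ξ
      rw [h.map_meet]; exact Pf.meet_mem ha hb),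
    Pf.maximal_of
      (fun a ha => by
        have ha' : h.toFun (A.diff a a) ∈ ξ := ha
        rw [h.map_diff] at ha'
        exact Pf.not_bot_mem (diff_self_le _) ha')
      (fun a b ha hb => by
        show h.toFun (A.diff a b) ∈ ξ
        rw [h.map_diff]
        exact Pf.diff_mem ha hb)⟩

/-- The partial function `Fh : Pf(B) ⇀ Pf(A)`: its domain is the union of the sets of maximal
filters containing some `h a`, and there `Fh ξ = h⁻¹(ξ)`. -/
def Hom.specFun (h : Hom A B) : B.Pf →. A.Pf :=
  fun ξ => ⟨∃ a : A, h.toFun a ∈ ξ, fun hne => h.comapPf ξ hne⟩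

theorem Hom.mem_specFun (h : Hom A B) (ξ : B.Pf) (μ : A.Pf) :
    μ ∈ h.specFun ξ ↔ ∀ a : A, a ∈ μ ↔ h.toFun a ∈ ξ := by
  constructor
  · rintro ⟨hne, rfl⟩ a
    exact Iff.rfl
  · intro hμ
    obtain ⟨a, ha⟩ := μ.nonempty
    exact ⟨⟨a, (hμ a).1 ha⟩, Pf.ext fun b => (hμ b).symm⟩

theorem Hom.mem_specFun_comp {A B C : DRA.{u}} (f : Hom A B) (g : Hom B C) (ξ : C.Pf) (μ : A.Pf) :
    (∀ a : A, a ∈ μ ↔ g.toFun (f.toFun a) ∈ ξ) ↔ ∃ ν ∈ g.specFun ξ, μ ∈ f.specFun ν := by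
  constructor
  · intro h
    obtain ⟨a, ha⟩ := μ.nonempty
    exact ⟨g.comapPf ξ ⟨_, (h a).1 ha⟩, ⟨⟨_, (h a).1 ha⟩, rfl⟩, (f.mem_specFun _ _).2 h⟩
  · rintro ⟨ν, hν, hμ⟩ a
    exact ((f.mem_specFun ν μ).1 hμ a).trans ((g.mem_specFun ξ ν).1 hν _)

theorem Hom.preimage_hat (h : Hom A B) (a : A) :
    h.specFun.preimage (Pf.hat a) = Pf.hat (h.toFun a) := by
  ext ξ
  rw [PFun.mem_preimage]
  constructor
  · rintro ⟨μ, hμ, hξ⟩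
    exact ((h.mem_specFun ξ μ).1 hξ a).1 hμ
  · intro hξ
    exact ⟨h.comapPf ξ ⟨a, hξ⟩, hξ, ⟨⟨a, hξ⟩, rfl⟩⟩

theorem Hom.specFun_continuous (h : Hom A B) (V : Set A.Pf) (hV : IsOpen V) :
    IsOpen (h.specFun.preimage V) := by
  rw [isOpen_iff_forall_mem_open]
  intro ξ hξ
  obtain ⟨μ, hμ, hξμ⟩ := (PFun.mem_preimage _ _ _).1 hξ
  obtain ⟨_, ⟨a, rfl⟩, ha, haV⟩ := Pf.isTopologicalBasis.exists_subset_of_mem_open hμ hV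
  refine ⟨h.specFun.preimage (Pf.hat a), PFun.preimage_mono _ haV, ?_, ⟨μ, ha, hξμ⟩⟩
  rw [h.preimage_hat]
  exact Pf.isOpen_hat _

theorem Hom.specFun_proper (h : Hom A B) (K : Set A.Pf) (hK : IsCompact K) :
    IsCompact (h.specFun.preimage K) := by
  obtain ⟨t, ht⟩ := Pf.exists_cover hK
  have hC : IsCompact (⋃ a ∈ t, Pf.hat (h.toFun a)) :=
    t.isCompact_biUnion fun a _ => Pf.isCompact_hat _
  have hO := h.specFun_continuous Kᶜ hK.isClosed.isOpen_compl
  convert hC.diff hO using 1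
  ext ξ
  simp only [PFun.mem_preimage, Set.mem_sdiff, Set.mem_iUnion]
  constructor
  · rintro ⟨μ, hμ, hξ⟩
    obtain ⟨a, ha, haμ⟩ : ∃ a, ∃ _ : a ∈ t, μ ∈ Pf.hat a := by simpa using ht hμ
    refine ⟨⟨a, ha, ((h.mem_specFun ξ μ).1 hξ a).1 haμ⟩, ?_⟩
    rintro ⟨ν, hν, hξν⟩
    exact hν (Part.mem_unique hξ hξν ▸ hμ)
  · rintro ⟨⟨a, ha, haξ⟩, hn⟩
    refine ⟨h.comapPf ξ ⟨a, haξ⟩, ?_, ⟨⟨a, haξ⟩, rfl⟩⟩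
    by_contra hK'
    exact hn ⟨_, hK', ⟨⟨a, haξ⟩, rfl⟩⟩

theorem Hom.specFun_equiv (h : Hom A B) {ξ ξ' : B.Pf} {μ μ' : A.Pf} (hμ : μ ∈ h.specFun ξ)
    (hμ' : μ' ∈ h.specFun ξ') (hξ : ξ ≈ ξ') : μ ≈ μ' := by
  rw [h.mem_specFun] at hμ hμ'
  refine Pf.equiv_iff.2 fun a ha b hb => ?_
  rw [hμ', h.map_restr]
  exact Pf.restr_mem hξ ((hμ a).1 ha) ((hμ' b).1 hb)

theorem Hom.specFun_fibre_surjective (h : Hom A B) {ξ : B.Pf} {μ μ' : A.Pf}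
    (hμ : μ ∈ h.specFun ξ) (heq : μ ≈ μ') : ∃ ζ : B.Pf, ζ ≈ ξ ∧ μ' ∈ h.specFun ζ := by
  obtain ⟨a, ha⟩ := μ.nonempty
  obtain ⟨b, hb⟩ := μ'.nonempty
  have hb' : h.toFun (A.restr b a) ∈ ξ :=
    (h.mem_specFun ξ μ |>.1 hμ _).1 (Pf.restr_mem (Setoid.symm heq) hb ha)
  rw [h.map_restr] at hb'
  obtain ⟨ζ, hζ, hζξ⟩ := Pf.exists_equiv_mem hb'
  refine ⟨ζ, hζξ, ?_⟩
  have hc : h.comapPf ζ ⟨b, hζ⟩ ∈ h.specFun ζ := ⟨⟨b, hζ⟩, rfl⟩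
  have he : h.comapPf ζ ⟨b, hζ⟩ ≈ μ' := Setoid.trans (h.specFun_equiv hc hμ hζξ) heq
  rwa [← Pf.eq_of_equiv he (c := b) hζ hb]

/-- The morphism of Hausdorff étale spaces induced by a homomorphism. -/
def specMap (h : Hom A B) : HausEt.Hom B.specObj A.specObj where
  φ := h.specFun
  continuous := h.specFun_continuous
  proper := h.specFun_proper
  preserves ξ ξ' μ hμ μ' hμ' hπ :=
    Pf.proj_eq.2 (h.specFun_equiv hμ hμ' (Pf.proj_eq.1 hπ))
  fibre_injective ξ ξ' μ hμ hμ' hπ := by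
    obtain ⟨a, ha⟩ := Pf.nonempty μ
    exact Pf.eq_of_equiv (Pf.proj_eq.1 hπ) ((h.mem_specFun ξ μ |>.1 hμ a).1 ha)
      ((h.mem_specFun ξ' μ |>.1 hμ' a).1 ha)
  fibre_surjective ξ μ hμ μ' hπ := by
    obtain ⟨ζ, hζ, h'⟩ := h.specFun_fibre_surjective hμ (Pf.proj_eq.1 hπ.symm)
    exact ⟨ζ, Pf.proj_eq.2 hζ, h'⟩

end DRA

/-- The functor `F`, sending `A` to `π_A` and `h` to the inverse image partial function. -/
def F : DRA.{u} ⥤ HausEt.{u}ᵒᵖ where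
  obj A := op A.specObj
  map h := Quiver.Hom.op (DRA.specMap h : _ ⟶ _)
  map_id A := by
    refine congrArg Quiver.Hom.op (HausEt.Hom.ext (PFun.ext fun ξ μ => ?_))
    exact (DRA.Hom.mem_specFun (𝟙 A : A ⟶ A) ξ μ).trans
      ⟨fun h => (HausEt.mem_id _ _).2 (DRA.Pf.ext h), fun h a => (HausEt.mem_id _ _).1 h ▸ Iff.rfl⟩
  map_comp f g := by
    refine congrArg Quiver.Hom.op (HausEt.Hom.ext (PFun.ext fun ξ μ => ?_))
    exact (DRA.Hom.mem_specFun (f ≫ g) ξ μ).trans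
      ((DRA.Hom.mem_specFun_comp f g ξ μ).trans (HausEt.mem_comp _ _ _ _).symm)

/-! ### The functor `G` -/

namespace HausEt

variable (E : HausEt.{u})

/-- The compact open subsets of `X` on which `π` is injective. -/
def KO : Type u := {U : Set E.X // IsCompact U ∧ IsOpen U ∧ Set.InjOn E.π U}

variable {E}

/-- Relative complement of sets in `KO(π)`. -/
def KO.diff (U V : E.KO) : E.KO :=
  ⟨U.1 \ V.1, U.2.1.diff V.2.2.1, U.2.2.1.sdiff V.2.1.isClosed, U.2.2.2.mono Set.sdiff_subset⟩

/-- The operation `U ▷ V = π⁻¹(π(U)) ∩ V` in `KO(π)`. -/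
def KO.restr (U V : E.KO) : E.KO :=
  ⟨E.π ⁻¹' (E.π '' U.1) ∩ V.1,
    V.2.1.inter_left ((U.2.1.image E.isLocalHomeomorph.continuous).isClosed.preimage
      E.isLocalHomeomorph.continuous),
    ((E.isLocalHomeomorph.isOpenMap _ U.2.2.1).preimage E.isLocalHomeomorph.continuous).inter
      V.2.2.1,
    V.2.2.2.mono Set.inter_subset_right⟩

/-- The partial section of `π` with image `U`. -/
noncomputable def KO.section (U : E.KO) : E.X₀ →. E.X :=
  fun p => ⟨∃ x ∈ U.1, E.π x = p, fun h => h.choose⟩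

theorem KO.mem_section (U : E.KO) (p : E.X₀) (x : E.X) :
    x ∈ U.section p ↔ x ∈ U.1 ∧ E.π x = p := by
  constructor
  · rintro ⟨h, rfl⟩
    exact h.choose_spec
  · rintro ⟨hx, hp⟩
    have h : ∃ x ∈ U.1, E.π x = p := ⟨x, hx, hp⟩
    exact ⟨h, U.2.2.2 h.choose_spec.1 hx (h.choose_spec.2.trans hp.symm)⟩

variable (E) in
/-- The difference–restriction algebra `KO(π)`. -/
def koObj : DRA.{u} where
  carrier := E.KO
  nonempty := ⟨⟨∅, isCompact_empty, isOpen_empty, Set.injOn_empty _⟩⟩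
  diff := KO.diff
  restr := KO.restr
  representable := by
    refine ⟨E.X₀, E.X, KO.section, fun U V h => ?_, fun U V => ?_, fun U V => ?_⟩
    · refine Subtype.ext (Set.ext fun x => ?_)
      have h1 := KO.mem_section U (E.π x) x
      have h2 := KO.mem_section V (E.π x) x
      rw [h] at h1
      simpa using h1.symm.trans h2
    · refine PFun.ext fun p x => ?_
      rw [mem_pfunDiff, KO.mem_section, KO.mem_section, KO.mem_section]
      simp only [KO.diff, Set.mem_sdiff]
      tauto
    · refine PFun.ext fun p x => ?_
      rw [mem_pfunRestr, KO.mem_section, KO.mem_section, PFun.mem_dom]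
      simp only [KO.restr, Set.mem_inter_iff, Set.mem_preimage, Set.mem_image, KO.mem_section]
      constructor
      · rintro ⟨⟨⟨y, hy, hyx⟩, hx⟩, rfl⟩
        exact ⟨⟨y, hy, hyx⟩, hx, rfl⟩
      · rintro ⟨⟨y, hy, hyx⟩, hx, rfl⟩
        exact ⟨⟨⟨y, hy, hyx⟩, hx⟩, rfl⟩

variable {E' : HausEt.{u}}

/-- The homomorphism `U ↦ φ⁻¹(U)` induced by a morphism `φ`. -/
def koMap (f : Hom E E') : DRA.Hom E'.koObj E.koObj where
  toFun U := ⟨f.φ.preimage U.1, f.proper _ U.2.1, f.continuous _ U.2.2.1, by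
    rintro x ⟨y, hy, hxy⟩ x' ⟨y', hy', hxy'⟩ h
    obtain rfl := U.2.2.2 hy hy' (f.preserves x x' y hxy y' hxy' h)
    exact f.fibre_injective x x' y hxy hxy' h⟩
  map_diff U V := by
    refine Subtype.ext (Set.ext fun x => ?_)
    constructor
    · rintro ⟨y, ⟨hU, hV⟩, hxy⟩
      exact ⟨⟨y, hU, hxy⟩, fun ⟨z, hz, hxz⟩ => hV (Part.mem_unique hxy hxz ▸ hz)⟩
    · rintro ⟨⟨y, hU, hxy⟩, hn⟩
      exact ⟨y, ⟨hU, fun hV => hn ⟨y, hV, hxy⟩⟩, hxy⟩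
  map_restr U V := by
    refine Subtype.ext (Set.ext fun x => ?_)
    constructor
    · rintro ⟨y, ⟨⟨z, hz, hzy⟩, hV⟩, hxy⟩
      obtain ⟨x', hx', hxz⟩ := f.fibre_surjective x y hxy z hzy
      exact ⟨⟨x', ⟨z, hz, hxz⟩, hx'⟩, ⟨y, hV, hxy⟩⟩
    · rintro ⟨⟨x', ⟨z, hz, hxz⟩, hx'⟩, ⟨y, hV, hxy⟩⟩
      exact ⟨y, ⟨⟨z, hz, f.preserves x' x z hxz y hxy hx'⟩, hV⟩, hxy⟩

end HausEt

/-- The functor `G`, sending `π` to `KO(π)` and `φ` to the inverse image map. -/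
def G : HausEt.{u}ᵒᵖ ⥤ DRA.{u} where
  obj E := E.unop.koObj
  map f := HausEt.koMap f.unop
  map_id _ := DRA.Hom.ext (funext fun U => Subtype.ext (HausEt.preimage_id U.1))
  map_comp _ _ := DRA.Hom.ext (funext fun U => Subtype.ext (PFun.preimage_comp _ _ U.1))

end DiffRestr

/-! The adjunction is of Stone type and is given by its unit and counit. The unit is `a ↦ â`, from
an algebra to the compact open sets of its spectrum; the counit, read in the category of spaces,
sends a point `x` to the filter of all members of `KO(π)` that contain `x`. This filter can be
empty, since a point need not have a compact open neighbourhood on which `π` is injective; so the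
counit is only a partial function.

That the unit is a homomorphism (`Pf.hat_diff`, `Pf.hat_restr`) rests on two facts about maximal
filters: they are prime with respect to difference, and a filter containing `a ▷ b` is equivalent to
one containing `a`. That the counit is a morphism (`pointHom`) rests on a third: equivalent maximal
filters with a common element are equal.

After that everything is membership chasing. By `mem_pointFun`, `ν` is the image of `x` exactly when
`U ∈ ν ↔ x ∈ U` for all `U`, and `Fh` has a similar description. Hence `â` pulls back along `Fh` to
the set of `h a`, and along the counit `Û` pulls back to `U`: the former is naturality of the unit,
the latter one triangle identity. The other triangle identity says that `μ` is recovered from the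
sets `â` containing it. -/

namespace DiffRestr

/-! ### The unit: algebra elements as compact open sets of maximal filters -/

namespace DRA

variable {A : DRA.{u}}

/-- The meet of `a - b` with `b` is a least element, which no proper filter contains; the other
inclusion is primeness of maximal filters. -/
theorem Pf.hat_diff (a b : A) : Pf.hat (A.diff a b) = Pf.hat a \ Pf.hat b := by
  ext μ
  exact ⟨fun h => ⟨up (diff_le a b) h, fun hb =>
    not_bot_mem (meet_diff_le a b) (meet_mem h hb)⟩, fun h => diff_mem h.1 h.2⟩

/-- One inclusion is the definition of `≈`. The other needs a new filter over the fibre of `ξ`,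
supplied by `exists_equiv_mem`. -/
theorem Pf.hat_restr (a b : A) :
    Pf.hat (A.restr a b) = proj ⁻¹' (proj '' Pf.hat a) ∩ Pf.hat b := by
  ext ξ
  constructor
  · intro h
    obtain ⟨ζ, hζ, hζξ⟩ := exists_equiv_mem h
    exact ⟨⟨ζ, hζ, proj_eq.2 hζξ⟩, up (restr_le a b) h⟩
  · rintro ⟨⟨ζ, hζ, hζξ⟩, hb⟩
    exact restr_mem (proj_eq.1 hζξ) hζ hb

theorem Pf.injOn_proj_hat (a : A) : Set.InjOn proj (Pf.hat a) :=
  fun _ hμ _ hν h => eq_of_equiv (proj_eq.1 h) hμ hν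

variable (A) in
/-- The homomorphism `a ↦ â` from `A` to the algebra of compact open sets of its spectrum. -/
def hatHom : Hom A A.specObj.koObj where
  toFun a := ⟨Pf.hat a, Pf.isCompact_hat a, Pf.isOpen_hat a, Pf.injOn_proj_hat a⟩
  map_diff a b := Subtype.ext (Pf.hat_diff a b)
  map_restr a b := Subtype.ext (Pf.hat_restr a b)

end DRA

/-! ### The counit: points of an étale space as maximal filters -/

namespace HausEt

variable {E : HausEt.{u}}

theorem KO.mem_meet {U V : E.KO} {x : E.X} :
    x ∈ (E.koObj.meet U V).1 ↔ x ∈ U.1 ∧ x ∈ V.1 := by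
  show x ∈ U.1 \ (U.1 \ V.1) ↔ _
  simp

theorem KO.subset_of_le {U V : E.koObj} (h : U ≤ V) : U.1 ⊆ V.1 := fun x hx => by
  rw [← DRA.le_iff.1 h] at hx
  exact (KO.mem_meet.1 hx).2

/-- The maximal filter of compact open sets containing a given point. -/
def pointPf (x : E.X) (hne : ∃ U : E.koObj, x ∈ U.1) : E.koObj.Pf :=
  ⟨DRA.mkFilter {U | x ∈ U.1} hne (fun h hU => KO.subset_of_le h hU)
    (fun hU hV => KO.mem_meet.2 ⟨hU, hV⟩),
    -- A point never lies in `U \ U`, and if it lies in `U` but not in `V` it lies in `U \ V`; this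
    -- is the criterion for maximality.
    DRA.Pf.maximal_of (fun _ h => h.2 h.1) (fun _ _ hU hV => ⟨hU, hV⟩)⟩

variable (E) in
/-- The partial function sending a point to the maximal filter of its compact open
neighbourhoods in `KO(π)`, defined where this filter is nonempty. -/
def pointFun : E.X →. E.koObj.Pf :=
  fun x => ⟨∃ U : E.koObj, x ∈ U.1, fun hne => pointPf x hne⟩

/-- The domain condition disappears from this description because a filter `ν` always has a member.
-/
theorem mem_pointFun {x : E.X} {ν : E.koObj.Pf} :
    ν ∈ E.pointFun x ↔ ∀ U : E.koObj, U ∈ ν ↔ x ∈ U.1 := by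
  constructor
  · rintro ⟨hne, rfl⟩ U
    exact Iff.rfl
  · intro h
    obtain ⟨U, hU⟩ := ν.nonempty
    exact ⟨⟨U, (h U).1 hU⟩, DRA.Pf.ext fun V => (h V).symm⟩

/-- This is the right triangle identity, and it also yields continuity and properness, since the
sets `Û` form a basis and finitely many of them cover any compact set. -/
theorem preimage_pointFun_hat (U : E.koObj) :
    E.pointFun.preimage (DRA.Pf.hat U) = U.1 := by
  ext x
  rw [PFun.mem_preimage]
  constructor
  · rintro ⟨ν, hν, hx⟩
    exact (mem_pointFun.1 hx U).1 hν
  · intro hx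
    exact ⟨pointPf x ⟨U, hx⟩, hx, ⟨⟨U, hx⟩, rfl⟩⟩

theorem pointFun_continuous (V : Set E.koObj.Pf) (hV : IsOpen V) :
    IsOpen (E.pointFun.preimage V) := by
  rw [isOpen_iff_forall_mem_open]
  intro x hx
  obtain ⟨ν, hν, hxν⟩ := (PFun.mem_preimage _ _ _).1 hx
  obtain ⟨_, ⟨U, rfl⟩, hU, hUV⟩ := DRA.Pf.isTopologicalBasis.exists_subset_of_mem_open hν hV
  refine ⟨E.pointFun.preimage (DRA.Pf.hat U), PFun.preimage_mono _ hUV, ?_, ⟨ν, hU, hxν⟩⟩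
  rw [preimage_pointFun_hat]
  exact U.2.2.1

theorem pointFun_proper (K : Set E.koObj.Pf) (hK : IsCompact K) :
    IsCompact (E.pointFun.preimage K) := by
  obtain ⟨t, ht⟩ := DRA.Pf.exists_cover hK
  have hC : IsCompact (⋃ U ∈ t, U.1) := t.isCompact_biUnion fun U _ => U.2.1
  have hO := pointFun_continuous Kᶜ hK.isClosed.isOpen_compl
  -- Every point of the finite union `⋃ U` is in the domain, so removing the open set of points sent
  -- outside `K` leaves exactly the preimage of `K`.
  convert hC.diff hO using 1
  ext x
  simp only [PFun.mem_preimage, Set.mem_sdiff, Set.mem_iUnion]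
  constructor
  · rintro ⟨ν, hν, hx⟩
    obtain ⟨U, hU, hUν⟩ : ∃ U, ∃ _ : U ∈ t, ν ∈ DRA.Pf.hat U := by simpa using ht hν
    refine ⟨⟨U, hU, (mem_pointFun.1 hx U).1 hUν⟩, ?_⟩
    rintro ⟨ν', hν', hx'⟩
    exact hν' (Part.mem_unique hx hx' ▸ hν)
  · rintro ⟨⟨U, hU, hxU⟩, hn⟩
    refine ⟨pointPf x ⟨U, hxU⟩, ?_, ⟨⟨U, hxU⟩, rfl⟩⟩
    by_contra hK'
    exact hn ⟨_, hK', ⟨⟨U, hxU⟩, rfl⟩⟩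

theorem pointFun_equiv {x x' : E.X} {μ ν : E.koObj.Pf} (hμ : μ ∈ E.pointFun x)
    (hν : ν ∈ E.pointFun x') (h : E.π x = E.π x') : μ ≈ ν := by
  rw [mem_pointFun] at hμ hν
  exact DRA.Pf.equiv_iff.2 fun U hU V hV =>
    -- The point `x ∈ U` lies in the fibre of `x' ∈ V`, so `x'` belongs to `U ▷ V`.
    (hν _).2 ⟨⟨x, (hμ U).1 hU, h⟩, (hν V).1 hV⟩

variable (E) in
/-- The canonical morphism from a Hausdorff étale space to the spectrum of `KO(π)`. -/
def pointHom : Hom E E.koObj.specObj where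
  φ := E.pointFun
  continuous := pointFun_continuous
  proper := pointFun_proper
  preserves _ _ _ hμ _ hν h := DRA.Pf.proj_eq.2 (pointFun_equiv hμ hν h)
  fibre_injective x x' ν hx hx' h := by
    -- Any member of `ν` contains both points, and `π` is injective on it.
    obtain ⟨U, hU⟩ := DRA.Pf.nonempty ν
    exact U.2.2.2 ((mem_pointFun.1 hx U).1 hU) ((mem_pointFun.1 hx' U).1 hU) h
  fibre_surjective x (μ : E.koObj.Pf) hμ (ν : E.koObj.Pf) h := by
    have hνμ : ν ≈ μ := DRA.Pf.proj_eq.1 h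
    obtain ⟨U, hU⟩ := DRA.Pf.nonempty μ
    obtain ⟨V, hV⟩ := DRA.Pf.nonempty ν
    -- Equivalence puts `V ▷ U` into `μ`, so `x` lies in it: the fibre of `x` meets `V`, in the
    -- required point `x'`.
    obtain ⟨⟨x', hx', hπ⟩, -⟩ :=
      (mem_pointFun.1 hμ _).1 (DRA.Pf.restr_mem hνμ hV hU)
    have hx : pointPf x' ⟨V, hx'⟩ ∈ E.pointFun x' := ⟨⟨V, hx'⟩, rfl⟩
    -- The filter of `x'` and `ν` are equivalent and share `V`, hence are equal.
    have he : pointPf x' ⟨V, hx'⟩ ≈ ν :=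
      Setoid.trans (pointFun_equiv hx hμ hπ) (Setoid.symm hνμ)
    exact ⟨x', hπ, DRA.Pf.eq_of_equiv he (c := V) hx' hV ▸ hx⟩

/-- Naturality of the canonical morphism to the spectrum. -/
theorem comp_pointHom {E' : HausEt.{u}} (f : Hom E E') :
    f.comp E'.pointHom = E.pointHom.comp (DRA.specMap (koMap f)) := by
  refine Hom.ext (PFun.ext fun x (ν : E'.koObj.Pf) => ?_)
  refine (mem_comp _ _ _ _).trans (Iff.trans ?_ (mem_comp _ _ _ _).symm)
  -- Both composites relate `x` to `ν` exactly when `V ∈ ν ↔ x ∈ φ⁻¹(V)` for all `V`; each direction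
  -- derives this as `h` and then finds the missing intermediate point.
  constructor
  · rintro ⟨y, hy, hν⟩
    have h (V : E'.koObj) : V ∈ ν ↔ x ∈ f.φ.preimage V.1 :=
      (mem_pointFun.1 hν V).trans
        ⟨fun hV => ⟨y, hV, hy⟩, fun ⟨_, hV, hz⟩ => Part.mem_unique hz hy ▸ hV⟩
    obtain ⟨V, hV⟩ := DRA.Pf.nonempty ν
    have hne : ∃ U : E.koObj, x ∈ U.1 := ⟨(koMap f).toFun V, (h V).1 hV⟩
    exact ⟨pointPf x hne, ⟨hne, rfl⟩, (DRA.Hom.mem_specFun _ _ _).2 h⟩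
  · rintro ⟨μ, hμ, hν⟩
    have h (V : E'.koObj) : V ∈ ν ↔ x ∈ f.φ.preimage V.1 :=
      ((DRA.Hom.mem_specFun _ _ _).1 hν V).trans (mem_pointFun.1 hμ _)
    obtain ⟨V, hV⟩ := DRA.Pf.nonempty ν
    -- A member of `ν` is what shows that `φ` is defined at `x`.
    obtain ⟨y, -, hy⟩ := (h V).1 hV
    exact ⟨y, hy, mem_pointFun.2 fun W => (h W).trans
      ⟨fun ⟨_, hW, hz⟩ => Part.mem_unique hz hy ▸ hW, fun hW => ⟨y, hW, hy⟩⟩⟩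

end HausEt

/-! ### The triangle identities and the adjunction -/

/-- The spectrum of `â` after the canonical morphism is the identity of the spectrum. -/
theorem DRA.pointHom_comp_specMap_hatHom (A : DRA.{u}) :
    A.specObj.pointHom.comp (DRA.specMap A.hatHom) = HausEt.Hom.id A.specObj := by
  refine HausEt.Hom.ext (PFun.ext fun ξ μ => ?_)
  refine (HausEt.mem_comp _ _ _ _).trans (Iff.trans ?_ (HausEt.mem_id _ _).symm)
  constructor
  · rintro ⟨ν, hν, hμ⟩
    exact DRA.Pf.ext fun a => ((DRA.Hom.mem_specFun _ _ _).1 hμ a).trans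
      (HausEt.mem_pointFun.1 hν _)
  · rintro rfl
    -- On a spectrum the point map is total: any `a ∈ μ` gives the neighbourhood `â` of `μ` in
    -- `KO(π_A)`.
    obtain ⟨a, ha⟩ := DRA.Pf.nonempty μ
    have hne : ∃ U : A.specObj.koObj, μ ∈ U.1 := ⟨A.hatHom.toFun a, ha⟩
    exact ⟨HausEt.pointPf μ hne, ⟨hne, rfl⟩, (DRA.Hom.mem_specFun _ _ _).2 fun _ => Iff.rfl⟩

/-- The adjunction with unit `a ↦ â` and counit given by the canonical morphisms from Hausdorff
étale spaces to the spectra of their algebras of compact open sets. -/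
def adjunction : F.{u} ⊣ G.{u} where
  unit :=
    { app := fun A => A.hatHom
      naturality := fun _ _ h => DRA.Hom.ext (funext fun a =>
        Subtype.ext (DRA.Hom.preimage_hat h a).symm) }
  counit :=
    { app := fun E => Quiver.Hom.op (HausEt.pointHom E.unop : E.unop ⟶ E.unop.koObj.specObj)
      naturality := fun _ _ f =>
        congrArg Quiver.Hom.op (HausEt.comp_pointHom f.unop).symm }
  left_triangle_components A := congrArg Quiver.Hom.op A.pointHom_comp_specMap_hatHom
  right_triangle_components _ := DRA.Hom.ext (funext fun U =>
    Subtype.ext (HausEt.preimage_pointFun_hat U))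

end DiffRestr

/-- The functors `F` and `G` form a contravariant adjunction, `F` being left adjoint to `G`. -/
theorem theorem3p14 : Nonempty (DiffRestr.F.{u} ⊣ DiffRestr.G.{u}) :=
  ⟨DiffRestr.adjunction⟩
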